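/- Let $n\ge 0$ be an integer and let $S^{n-1}$ be the unit sphere in Euclidean space $\mathbb R^n$ (empty if $n=0$). A subset $V\subseteq S^{n-1}$ is called $n$-tame if every non-empty subset of $V$ with at most $n$ points is contained in some open hemisphere $\{x\in S^{n-1} : \langle x,v\rangle>0\}$, $v\in S^{n-1}$. A subset $W\subseteq S^{n-1}$ is called weakly maxtame if it is open in $S^{n-1}$, is $n$-tame, has finitely many connected components, and is maximal with respect to inclusion among the open $n$-tame subsets of $S^{n-1}$ that have at most as many connected components as $W$. A weakly maxtame set is called maxtame if it is maximal with respect to inclusion among all open $n$-tame subsets of $S^{n-1}$. Theorem B. Let $U\subseteq S^{n-1}$ be an $n$-tame set which is either closed in $S^{n-1}$, or open in $S^{n-1}$ with finitely many connected components. Then: (B1) $U$ is contained in a weakly maxtame subset of $S^{n-1}$. (B2) If $n\le 3$, then $U$ is contained in a maxtame subset of $S^{n-1}$. -/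

import Mathlib

/-- The unit sphere `S^{n-1}` in Euclidean space `ℝⁿ` (empty for `n = 0`), as a topological space. -/
abbrev UnitSphere (n : ℕ) : Type :=
  Metric.sphere (0 : EuclideanSpace ℝ (Fin n)) 1

/-- The open hemisphere of `S^{n-1}` centred at `v`. -/
def openHemisphere {n : ℕ} (v : UnitSphere n) : Set (UnitSphere n) :=
  {x | 0 < inner ℝ (x : EuclideanSpace ℝ (Fin n)) (v : EuclideanSpace ℝ (Fin n))}

/-- `V ⊆ S^{n-1}` is `m`-tame: every non-empty subset of `V` with at most `m` points lies in some
open hemisphere. -/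
def IsTame {n : ℕ} (m : ℕ) (V : Set (UnitSphere n)) : Prop :=
  ∀ F : Finset (UnitSphere n), F.Nonempty → F.card ≤ m → (F : Set (UnitSphere n)) ⊆ V →
    ∃ v : UnitSphere n, (F : Set (UnitSphere n)) ⊆ openHemisphere v

/-- The number of connected components of `V ⊆ S^{n-1}`, possibly infinite. -/
noncomputable def numComponents {n : ℕ} (V : Set (UnitSphere n)) : ℕ∞ :=
  ENat.card (ConnectedComponents V)

/-- `U ⊆ S^{n-1}` is weakly maxtame: it is open and `n`-tame, has finitely many components, and is
maximal (for inclusion) among the open `n`-tame sets with at most as many components as `U`. -/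
def IsWeaklyMaxtame {n : ℕ} (U : Set (UnitSphere n)) : Prop :=
  IsOpen U ∧ IsTame n U ∧ Finite (ConnectedComponents U) ∧
    Maximal (fun V : Set (UnitSphere n) =>
      IsOpen V ∧ IsTame n V ∧ numComponents V ≤ numComponents U) U

/-- `U ⊆ S^{n-1}` is maxtame: it is weakly maxtame and maximal (for inclusion) among all open
`n`-tame sets. -/
def IsMaxtame {n : ℕ} (U : Set (UnitSphere n)) : Prop :=
  IsWeaklyMaxtame U ∧ Maximal (fun V : Set (UnitSphere n) => IsOpen V ∧ IsTame n V) U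

/-! The argument runs in open cones of `ℝⁿ`, where tameness says that no nontrivial sum of at most
`n` elements vanishes (`IsTame.coneTame`, `ConeTame.isTame`).

Finitely many hemispheres suffice to capture all `n`-tuples of `U`: for closed `U` by compactness of
`Uⁿ`; for open `U` because any `n` components share a hemisphere, by the Fenchel–Bunt form of
Carathéodory's theorem (`zero_notMem_convexHull_iUnion`). Hence `U` lies in an open tame cone `A`
cut out by the signs of finitely many functionals. Such a cone is a finite union of convex cells, so
its trace on the sphere has finitely many components, and Zorn's lemma gives a weakly maxtame set:
along chains of sets neither tameness nor a bound on the number of components is lost.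

For `n ≤ 3`, Zorn's lemma also gives a maximal open tame set, but its components must be shown
finite in number. So `A` is first enlarged, cell by cell, to a semilinear tame cone `B` whose open
tame extensions all lie in `closure B` (`IsTameCone.exists_subset_closure`). A set between `B` and
its closure inherits the finiteness. The bound 3 enters in `ConeTame.union`: once two terms of a
vanishing sum are new, at most one old term is left. -/

/-- Membership in `A` depends only on the signs of the linear functionals in `F`. -/
def SignDefinable {V : Type*} [AddCommGroup V] [Module ℝ V] (F : Set (Module.Dual ℝ V))
    (A : Set V) : Prop :=
  ∀ x y, (∀ f ∈ F, SignType.sign (f x) = SignType.sign (f y)) → x ∈ A → y ∈ A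

/-- A (conical) semilinear set: one that is sign-definable by finitely many functionals. -/
def Semilinear {V : Type*} [AddCommGroup V] [Module ℝ V] (A : Set V) : Prop :=
  ∃ F : Set (Module.Dual ℝ V), F.Finite ∧ SignDefinable F A

/-! ### Semilinear cones and Fourier–Motzkin elimination. -/

section Semilinear

variable {V W : Type*} [AddCommGroup V] [Module ℝ V] [AddCommGroup W] [Module ℝ W]

theorem SignDefinable.mono {F G : Set (Module.Dual ℝ V)} {A : Set V} (h : SignDefinable F A)
    (hFG : F ⊆ G) : SignDefinable G A :=
  fun x y hxy hx => h x y (fun f hf => hxy f (hFG hf)) hx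

theorem SignDefinable.compl {F : Set (Module.Dual ℝ V)} {A : Set V} (h : SignDefinable F A) :
    SignDefinable F Aᶜ :=
  fun x y hxy hx hy => hx (h y x (fun f hf => (hxy f hf).symm) hy)

/-- The zero functional carries no sign information, but its presence would make `nonvanishing F`
empty. -/
theorem SignDefinable.diff_zero {F : Set (Module.Dual ℝ V)} {A : Set V} (h : SignDefinable F A) :
    SignDefinable (F \ {0}) A := by
  intro x y hxy hx
  refine h x y (fun f hf => ?_) hx
  by_cases h0 : f = 0
  · simp [h0]
  · exact hxy f ⟨hf, h0⟩

theorem SignDefinable.smul_mem {F : Set (Module.Dual ℝ V)} {A : Set V} (h : SignDefinable F A)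
    {x : V} (hx : x ∈ A) {r : ℝ} (hr : 0 < r) : r • x ∈ A := by
  refine h x _ (fun f _ => ?_) hx
  simp [sign_mul, sign_pos hr]

theorem SignDefinable.neg_preimage {F : Set (Module.Dual ℝ V)} {A : Set V}
    (h : SignDefinable F A) : SignDefinable F {x | -x ∈ A} := by
  intro x y hxy hx
  refine h (-x) (-y) (fun f hf => ?_) hx
  simp [Left.sign_neg, hxy f hf]

theorem Semilinear.compl {A : Set V} (h : Semilinear A) : Semilinear Aᶜ :=
  let ⟨F, hF, hA⟩ := h
  ⟨F, hF, hA.compl⟩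

theorem Semilinear.neg_preimage {A : Set V} (h : Semilinear A) : Semilinear {x | -x ∈ A} :=
  let ⟨F, hF, hA⟩ := h
  ⟨F, hF, hA.neg_preimage⟩

theorem Semilinear.smul_mem {A : Set V} (h : Semilinear A)
    {x : V} (hx : x ∈ A) {r : ℝ} (hr : 0 < r) : r • x ∈ A :=
  let ⟨_, _, hA⟩ := h
  hA.smul_mem hx hr

theorem Semilinear.inter {A B : Set V} (hA : Semilinear A) (hB : Semilinear B) :
    Semilinear (A ∩ B) := by
  obtain ⟨F, hF, hA⟩ := hA
  obtain ⟨G, hG, hB⟩ := hB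
  exact ⟨F ∪ G, hF.union hG, fun x y hxy hx =>
    ⟨hA.mono Set.subset_union_left x y hxy hx.1, hB.mono Set.subset_union_right x y hxy hx.2⟩⟩

theorem Semilinear.union {A B : Set V} (hA : Semilinear A) (hB : Semilinear B) :
    Semilinear (A ∪ B) := by
  have := (hA.compl.inter hB.compl).compl
  rwa [← Set.compl_union, compl_compl] at this

theorem Semilinear.preimage {A : Set W} (hA : Semilinear A) (g : V →ₗ[ℝ] W) :
    Semilinear (g ⁻¹' A) := by
  obtain ⟨F, hF, hA⟩ := hA
  refine ⟨(fun f => f.comp g) '' F, hF.image _, fun x y hxy hx => ?_⟩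
  exact hA (g x) (g y) (fun f hf => hxy _ ⟨f, hf, rfl⟩) hx

theorem semilinear_zero [FiniteDimensional ℝ V] : Semilinear ({0} : Set V) := by
  let b := Module.finBasis ℝ V
  refine ⟨Set.range b.coord, Set.finite_range _, fun x y hxy hx => ?_⟩
  rw [Set.mem_singleton_iff] at hx ⊢
  subst hx
  refine b.forall_coord_eq_zero_iff.1 fun i => ?_
  have := hxy (b.coord i) ⟨i, rfl⟩
  rw [map_zero, sign_zero] at this
  exact sign_eq_zero_iff.1 this.symm

/-- One step of Fourier–Motzkin elimination. -/
theorem Semilinear.saturate {A : Set V} (hA : Semilinear A) (u : V) :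
    Semilinear {x | ∃ t : ℝ, x + t • u ∈ A} := by
  obtain ⟨F, hF, hA⟩ := hA
  let G : Set (Module.Dual ℝ V) :=
    F ∪ (fun p : Module.Dual ℝ V × Module.Dual ℝ V =>
      (p.1 u)⁻¹ • p.1 - (p.2 u)⁻¹ • p.2) '' (F ×ˢ F)
  refine ⟨G, hF.union ((hF.prod hF).image _), ?_⟩
  rintro x y hxy ⟨t, ht⟩
  -- For `f u ≠ 0` this is the root of `s ↦ f (z + s • u)`. For `f u = 0` the convention `0⁻¹ = 0`
  -- makes it 0; the comparisons below still hold, and such `f` are treated separately at the end.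
  let ρ : V → Module.Dual ℝ V → ℝ := fun z f => -((f u)⁻¹ * f z)
  have hsign : ∀ (z : V) (s : ℝ) (f : Module.Dual ℝ V), f u ≠ 0 →
      SignType.sign (f (z + s • u)) = SignType.sign (f u) * SignType.sign (s - ρ z f) := by
    intro z s f hfu
    rw [← sign_mul]
    congr 1
    simp only [ρ, map_add, map_smul, smul_eq_mul]
    field_simp
    ring
  have hcmp : ∀ f ∈ F, ∀ g ∈ F, SignType.sign (ρ x g - ρ x f) = SignType.sign (ρ y g - ρ y f) := by
    intro f hf g hg
    have := hxy ((f u)⁻¹ • f - (g u)⁻¹ • g) (Or.inr ⟨(f, g), ⟨hf, hg⟩, rfl⟩)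
    have e : ∀ z, ρ z g - ρ z f = ((f u)⁻¹ • f - (g u)⁻¹ • g) z := by
      intro z
      simp only [ρ, LinearMap.sub_apply, LinearMap.smul_apply, smul_eq_mul]
      ring
    rw [e, e, this]
  have hlt : ∀ f ∈ F, ∀ g ∈ F, ρ x f < ρ x g → ρ y f < ρ y g := by
    intro f hf g hg h
    have h1 := hcmp f hf g hg
    rw [sign_pos (sub_pos.2 h)] at h1
    exact sub_pos.1 (sign_eq_one_iff.1 h1.symm)
  -- `s` is placed among the roots `ρ y f` exactly as `t` lies among the roots `ρ x f`, which are
  -- ordered in the same way.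
  have key : ∃ s : ℝ, ∀ f ∈ F, f u ≠ 0 →
      SignType.sign (t - ρ x f) = SignType.sign (s - ρ y f) := by
    by_cases hex : ∃ f ∈ F, ρ x f = t
    · obtain ⟨f, hf, rfl⟩ := hex
      exact ⟨ρ y f, fun g hg _ => hcmp g hg f hf⟩
    · push Not at hex
      classical
      obtain ⟨s, h1, h2⟩ := Order.exists_between_finsets
        ((hF.toFinset.filter (fun f => ρ x f < t)).image (ρ y))
        ((hF.toFinset.filter (fun f => t < ρ x f)).image (ρ y)) (by
          simp only [Finset.mem_image, Finset.mem_filter, Set.Finite.mem_toFinset]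
          rintro _ ⟨f, ⟨hf, hft⟩, rfl⟩ _ ⟨g, ⟨hg, hgt⟩, rfl⟩
          exact hlt f hf g hg (hft.trans hgt))
      simp only [Finset.mem_image, Finset.mem_filter, Set.Finite.mem_toFinset] at h1 h2
      refine ⟨s, fun f hf _ => ?_⟩
      rcases lt_or_gt_of_ne (hex f hf) with h | h
      · rw [sign_pos (sub_pos.2 h), sign_pos (sub_pos.2 (h1 _ ⟨f, ⟨hf, h⟩, rfl⟩))]
      · rw [sign_neg (sub_neg.2 h), sign_neg (sub_neg.2 (h2 _ ⟨f, ⟨hf, h⟩, rfl⟩))]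
  obtain ⟨s, hs⟩ := key
  refine ⟨s, hA _ _ (fun f hf => ?_) ht⟩
  by_cases hfu : f u = 0
  · simpa [hfu] using hxy f (Or.inl hf)
  · rw [hsign x t f hfu, hsign y s f hfu, hs f hf hfu]

theorem Semilinear.saturate_submodule (N : Submodule ℝ V) (hN : N.FG) :
    ∀ A : Set V, Semilinear A → Semilinear {x | ∃ w ∈ N, x + w ∈ A} := by
  induction N, hN using Submodule.fg_induction with
  | singleton u =>
    intro A hA
    convert hA.saturate u using 3 with x
    simp only [Submodule.mem_span_singleton]
    constructor
    · rintro ⟨_, ⟨t, rfl⟩, h⟩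
      exact ⟨t, h⟩
    · rintro ⟨t, h⟩
      exact ⟨_, ⟨t, rfl⟩, h⟩
  | sup N₁ N₂ _ _ h₁ h₂ =>
    intro A hA
    convert h₁ _ (h₂ A hA) using 3 with x
    simp only [Submodule.mem_sup]
    constructor
    · rintro ⟨_, ⟨y, hy, z, hz, rfl⟩, h⟩
      exact ⟨y, hy, z, hz, by rwa [add_assoc]⟩
    · rintro ⟨y, hy, z, hz, h⟩
      exact ⟨_, ⟨y, hy, z, hz, rfl⟩, by rwa [← add_assoc]⟩

/-- The sum is the projection to `x` of the set of pairs `(x, y)` with `y ∈ A` and `x - y ∈ B`;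
eliminating `y` keeps it semilinear. -/
theorem Semilinear.add [FiniteDimensional ℝ V] {A B : Set V} (hA : Semilinear A)
    (hB : Semilinear B) : Semilinear {x | ∃ y ∈ A, ∃ z ∈ B, y + z = x} := by
  have h1 : Semilinear (LinearMap.snd ℝ V V ⁻¹' A ∩
      (LinearMap.fst ℝ V V - LinearMap.snd ℝ V V) ⁻¹' B) :=
    (hA.preimage _).inter (hB.preimage _)
  have h2 := (Semilinear.saturate_submodule (LinearMap.range (LinearMap.inr ℝ V V))
    (IsNoetherian.noetherian _) _ h1).preimage (LinearMap.inl ℝ V V)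
  convert h2 using 1
  ext x
  constructor
  · rintro ⟨y, hy, z, hz, rfl⟩
    exact ⟨(0, y), ⟨y, rfl⟩, by simpa using hy, by simpa using hz⟩
  · rintro ⟨_, ⟨y, rfl⟩, hy, hz⟩
    refine ⟨y, by simpa using hy, x - y, by simpa using hz, by abel⟩

/-- The sums of `j` elements of `A ∪ {0}`. -/
def sumsOf (A : Set V) (j : ℕ) : Set V :=
  {x | ∃ z : Fin j → V, (∀ i, z i ∈ A ∨ z i = 0) ∧ ∑ i, z i = x}

theorem Semilinear.sumsOf [FiniteDimensional ℝ V] {A : Set V} (hA : Semilinear A) (j : ℕ) :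
    Semilinear (sumsOf A j) := by
  induction j with
  | zero =>
    convert semilinear_zero (V := V) using 1
    ext x
    constructor
    · rintro ⟨z, _, rfl⟩
      simp
    · rintro rfl
      exact ⟨0, fun i => i.elim0, by simp⟩
  | succ j ih =>
    convert (hA.union semilinear_zero).add ih using 1
    ext x
    constructor
    · rintro ⟨z, hz, rfl⟩
      exact ⟨z 0, hz 0, _, ⟨fun i => z i.succ, fun i => hz _, rfl⟩, (Fin.sum_univ_succ z).symm⟩
    · rintro ⟨y, hy, _, ⟨z, hz, rfl⟩, rfl⟩
      refine ⟨Fin.cons y z, fun i => ?_, by simp [Fin.sum_univ_succ]⟩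
      refine Fin.cases ?_ (fun i => ?_) i
      · simpa [or_comm] using hy
      · simpa using hz i

/-- The set where the functionals in `F` have the signs prescribed by `σ`. -/
def signCell (F : Set (Module.Dual ℝ V)) (σ : F → SignType) : Set V :=
  {x | ∀ f : F, SignType.sign (f.1 x) = σ f}

theorem signDefinable_signCell (F : Set (Module.Dual ℝ V)) (σ : F → SignType) :
    SignDefinable F (signCell F σ) :=
  fun _ _ hxy hx f => (hxy f.1 f.2).symm.trans (hx f)

theorem mem_signCell_self (F : Set (Module.Dual ℝ V)) (x : V) :
    x ∈ signCell F fun f => SignType.sign (f.1 x) :=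
  fun _ => rfl

theorem SignDefinable.mem_of_mem_signCell {F : Set (Module.Dual ℝ V)} {A : Set V}
    (h : SignDefinable F A) {σ : F → SignType} {x y : V} (hx : x ∈ signCell F σ)
    (hy : y ∈ signCell F σ) (hxA : x ∈ A) : y ∈ A :=
  h x y (fun f hf => (hx ⟨f, hf⟩).trans (hy ⟨f, hf⟩).symm) hxA

theorem sign_add_of_sign_eq {a b : ℝ} {s : SignType} (ha : SignType.sign a = s)
    (hb : SignType.sign b = s) : SignType.sign (a + b) = s := by
  subst ha
  rcases lt_trichotomy a 0 with h | rfl | h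
  · rw [sign_neg h] at hb ⊢
    exact sign_neg (add_neg h (sign_eq_neg_one_iff.1 hb))
  · rwa [zero_add]
  · rw [sign_pos h] at hb ⊢
    exact sign_pos (add_pos h (sign_eq_one_iff.1 hb))

theorem add_mem_signCell {F : Set (Module.Dual ℝ V)} {σ : F → SignType} {x y : V}
    (hx : x ∈ signCell F σ) (hy : y ∈ signCell F σ) : x + y ∈ signCell F σ := by
  intro f
  rw [map_add]
  exact sign_add_of_sign_eq (hx f) (hy f)

theorem convex_signCell (F : Set (Module.Dual ℝ V)) (σ : F → SignType) :
    Convex ℝ (signCell F σ) := by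
  rw [convex_iff_forall_pos]
  intro x hx y hy a b ha hb _
  exact add_mem_signCell ((signDefinable_signCell F σ).smul_mem hx ha)
    ((signDefinable_signCell F σ).smul_mem hy hb)

/-- The points at which no functional in `F` vanishes. -/
def nonvanishing (F : Set (Module.Dual ℝ V)) : Set V :=
  {x | ∀ f ∈ F, f x ≠ 0}

theorem signDefinable_nonvanishing (F : Set (Module.Dual ℝ V)) :
    SignDefinable F (nonvanishing F) := by
  intro x y hxy hx f hf h0
  refine hx f hf ?_
  have := hxy f hf
  rwa [h0, sign_zero, sign_eq_zero_iff] at this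

end Semilinear

/-! ### Genericity: complements of finitely many hyperplanes. -/

section Topology

variable {V : Type*} [NormedAddCommGroup V] [NormedSpace ℝ V] [FiniteDimensional ℝ V]

theorem dense_nonvanishing {F : Set (Module.Dual ℝ V)} (hF : F.Finite) (h0 : 0 ∉ F) :
    Dense (nonvanishing F) := by
  have : nonvanishing F = ⋂ f ∈ F, {x : V | f x ≠ 0} := by
    ext x
    simp [nonvanishing]
  rw [this]
  have := FiniteDimensional.complete ℝ V
  refine dense_biInter_of_isOpen (fun f _ => ?_) hF.countable (fun f hf => ?_)
  · exact isOpen_ne_fun f.continuous_of_finiteDimensional continuous_const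
  · have h := interior_eq_empty_iff_dense_compl (s := (LinearMap.ker f : Set V))
    refine h.1 ?_
    by_contra hne
    have := Submodule.eq_top_of_nonempty_interior' _ (Set.nonempty_iff_ne_empty.2 hne)
    exact h0 (by rwa [← LinearMap.ker_eq_top.1 this])

/-- Off their hyperplanes the functionals have locally constant signs. -/
theorem SignDefinable.isOpen_inter_nonvanishing {F : Set (Module.Dual ℝ V)} (hF : F.Finite)
    {A : Set V} (hA : SignDefinable F A) : IsOpen (A ∩ nonvanishing F) := by
  rw [isOpen_iff_mem_nhds]
  rintro x ⟨hxA, hx⟩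
  have : ∀ᶠ y in nhds x, ∀ f ∈ F, SignType.sign (f x) = SignType.sign (f y) := by
    rw [Filter.eventually_all_finite hF]
    intro f hf
    have hc : ContinuousAt f x := f.continuous_of_finiteDimensional.continuousAt
    rcases lt_or_gt_of_ne (hx f hf) with h | h
    · filter_upwards [hc.eventually (gt_mem_nhds h)] with y hy
      rw [sign_neg h, sign_neg hy]
    · filter_upwards [hc.eventually (lt_mem_nhds h)] with y hy
      rw [sign_pos h, sign_pos hy]
  filter_upwards [this] with y hy
  refine ⟨hA x y hy hxA, fun f hf h0 => hx f hf ?_⟩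
  have := hy f hf
  rwa [h0, sign_zero, sign_eq_zero_iff] at this

end Topology

/-! ### Tameness as a condition on vanishing sums. -/

section ConeTame

variable {V : Type*} [AddCommGroup V]

/-- No nontrivial vanishing sum of at most `m` elements of `A`. -/
def ConeTame (m : ℕ) (A : Set V) : Prop :=
  ∀ z : Fin m → V, (∀ i, z i ∈ A ∨ z i = 0) → ∑ i, z i = 0 → ∀ i, z i = 0

/-- The directions which every tame set containing `A` has to avoid. -/
def excluded (m : ℕ) (A : Set V) : Set V :=
  {x | -x ∈ sumsOf A (m - 1)}

theorem ConeTame.notMem_excluded {m : ℕ} (hm : 1 ≤ m) {A A' : Set V} (hA' : ConeTame m A')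
    (h : A ⊆ A') {x : V} (hx : x ∈ A') (hx0 : x ≠ 0) : x ∉ excluded m A := by
  obtain ⟨m, rfl⟩ := Nat.exists_eq_add_of_le' hm
  rintro ⟨z, hz, hsum⟩
  refine hx0 (hA' (Fin.cons x z) (fun i => ?_) ?_ 0)
  · refine Fin.cases (Or.inl hx) (fun i => ?_) i
    exact (hz i).imp (fun hi => h hi) id
  · simp only [Fin.sum_univ_succ, Fin.cons_zero, Fin.cons_succ]
    exact (congrArg (x + ·) hsum).trans (add_neg_cancel x)

/-- Count the terms of a vanishing sum that lie in `N`. None: tameness of `A` applies. One: that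
term is excluded. At least two: they add up to an element of `Q`, and since `m ≤ 3` at most one
other term remains, either 0 or an element of `A` whose negative is in `Q`. -/
theorem ConeTame.union {m : ℕ} (hm : m ≤ 3) {A N Q : Set V} (hA : ConeTame m A)
    (hNQ : N ⊆ Q) (hN : ∀ x ∈ N, x ∉ excluded m A)
    (hQadd : ∀ x ∈ Q, ∀ y ∈ Q, x + y ∈ Q) (hQ0 : (0 : V) ∉ Q) (hQA : 2 ≤ m → ∀ x ∈ Q, -x ∉ A) :
    ConeTame m (A ∪ N) := by
  classical
  intro z hz hsum
  let I : Finset (Fin m) := Finset.univ.filter fun i => z i ∈ N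
  have hI : ∀ i, i ∉ I → z i ∈ A ∨ z i = 0 := by
    intro i hi
    have : z i ∉ N := by simpa [I] using hi
    rcases hz i with (h | h) | h
    · exact Or.inl h
    · exact absurd h this
    · exact Or.inr h
  have hIN : ∀ i ∈ I, z i ∈ N := by simp [I]
  have hcard : I.card ≤ m := by simpa using I.card_le_univ
  rcases lt_trichotomy I.card 1 with h | h | h
  · have : I = ∅ := Finset.card_eq_zero.1 (by omega)
    exact hA z (fun i => hI i (by simp [this])) hsum
  · obtain ⟨i₀, hi₀⟩ := Finset.card_eq_one.1 h
    exfalso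
    obtain ⟨m, rfl⟩ : ∃ k, m = k + 1 := ⟨m - 1, by omega⟩
    refine hN (z i₀) (hIN i₀ (by simp [hi₀])) ⟨fun i => z (i₀.succAbove i), fun i => ?_, ?_⟩
    · exact hI _ (by simp [hi₀, Fin.succAbove_ne])
    · rw [Fin.sum_univ_succAbove z i₀] at hsum
      exact (neg_eq_of_add_eq_zero_right hsum).symm
  · exfalso
    have hq : ∑ i ∈ I, z i ∈ Q :=
      Finset.sum_induction_nonempty z (· ∈ Q) (fun a b ha hb => hQadd a ha b hb)
        (Finset.card_pos.1 (by omega)) (fun i hi => hNQ (hIN i hi))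
    rw [← Finset.sum_add_sum_compl I] at hsum
    have hc : Iᶜ.card ≤ 1 := by
      rw [Finset.card_compl, Fintype.card_fin]
      omega
    rcases Nat.le_one_iff_eq_zero_or_eq_one.1 hc with hj | hj
    · rw [Finset.card_eq_zero] at hj
      rw [hj, Finset.sum_empty, add_zero] at hsum
      exact hQ0 (hsum ▸ hq)
    · obtain ⟨j, hj⟩ := Finset.card_eq_one.1 hj
      rw [hj, Finset.sum_singleton] at hsum
      have hzj : z j = -∑ i ∈ I, z i := (neg_eq_of_add_eq_zero_right hsum).symm
      rcases hI j (by rw [← Finset.mem_compl, hj]; simp) with h' | h'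
      · exact hQA (by omega) _ hq (hzj ▸ h')
      · rw [h', add_zero] at hsum
        exact hQ0 (hsum ▸ hq)

end ConeTame

/-! ### Saturating a tame semilinear cone when `m ≤ 3`. -/

section Completion

variable {V : Type*} [NormedAddCommGroup V] [NormedSpace ℝ V]

/-- An open tame semilinear cone. -/
structure IsTameCone (m : ℕ) (A : Set V) : Prop where
  isOpen : IsOpen A
  semilinear : Semilinear A
  zero_notMem : (0 : V) ∉ A
  coneTame : ConeTame m A

/-- Up to a finite union of hyperplanes, no tame set containing `A` gains points in `S`. -/
def IsSaturatedOn (m : ℕ) (A S : Set V) : Prop :=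
  ∃ G : Set (Module.Dual ℝ V), G.Finite ∧ 0 ∉ G ∧
    ∀ A', A ⊆ A' → (0 : V) ∉ A' → ConeTame m A' → A' ∩ S ∩ nonvanishing G ⊆ A

theorem IsSaturatedOn.mono_left {m : ℕ} {A B S : Set V} (h : IsSaturatedOn m A S) (hAB : A ⊆ B) :
    IsSaturatedOn m B S :=
  let ⟨G, hG, h0, H⟩ := h
  ⟨G, hG, h0, fun A' hA' h0' ht => (H A' (hAB.trans hA') h0' ht).trans hAB⟩

theorem IsSaturatedOn.union {m : ℕ} {A S T : Set V} (hS : IsSaturatedOn m A S)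
    (hT : IsSaturatedOn m A T) : IsSaturatedOn m A (S ∪ T) := by
  obtain ⟨G, hG, h0, HS⟩ := hS
  obtain ⟨G', hG', h0', HT⟩ := hT
  refine ⟨G ∪ G', hG.union hG', by simp [h0, h0'], fun A' hA' hz ht => ?_⟩
  rintro x ⟨⟨hxA, hx | hx⟩, hxg⟩
  · exact HS A' hA' hz ht ⟨⟨hxA, hx⟩, fun f hf => hxg f (Or.inl hf)⟩
  · exact HT A' hA' hz ht ⟨⟨hxA, hx⟩, fun f hf => hxg f (Or.inr hf)⟩

variable [FiniteDimensional ℝ V]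

/-- Every point of `Q` that is not excluded and avoids the hyperplanes is adjoined at once. A tame
extension cannot contain excluded points, so in `Q` it gains nothing more off the hyperplanes. -/
theorem IsTameCone.exists_saturatedOn_convex {m : ℕ} (hm1 : 1 ≤ m) (hm : m ≤ 3) {A Q : Set V}
    (hA : IsTameCone m A) (hQ : Semilinear Q) (hQadd : ∀ x ∈ Q, ∀ y ∈ Q, x + y ∈ Q)
    (hQ0 : (0 : V) ∉ Q) (hQA : 2 ≤ m → ∀ x ∈ Q, -x ∉ A) :
    ∃ B, A ⊆ B ∧ B ⊆ A ∪ Q ∧ IsTameCone m B ∧ IsSaturatedOn m B Q := by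
  obtain ⟨F, hF, hR⟩ := hQ.inter (hA.semilinear.sumsOf (m - 1)).neg_preimage.compl
  have hF' : (F \ {0}).Finite := hF.subset Set.sdiff_subset
  have hR' := hR.diff_zero
  refine ⟨A ∪ _ ∩ nonvanishing (F \ {0}), Set.subset_union_left,
    Set.union_subset_union_right _ fun x hx => hx.1.1,
    ⟨hA.isOpen.union (hR'.isOpen_inter_nonvanishing hF'), hA.semilinear.union
      (Semilinear.inter ⟨_, hF', hR'⟩ ⟨_, hF', signDefinable_nonvanishing _⟩), ?_, ?_⟩,
      ⟨F \ {0}, hF', by simp, ?_⟩⟩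
  · rintro (h | h)
    · exact hA.zero_notMem h
    · exact hQ0 h.1.1
  · exact hA.coneTame.union hm (fun x hx => hx.1.1) (fun x hx => hx.1.2) hQadd hQ0 hQA
  · rintro A' hA' hz ht x ⟨⟨hx, hxQ⟩, hxg⟩
    exact Or.inr ⟨⟨hxQ, ht.notMem_excluded hm1 (Set.subset_union_left.trans hA') hx
      (fun h => hz (h ▸ hx))⟩, hxg⟩

/-- The sign cells of `A` are treated one after another. Since points are added only where `h > 0`,
no added point is the negative of a point in a later cell. -/
theorem IsTameCone.exists_saturatedOn_halfSpace {m : ℕ} (hm1 : 1 ≤ m) (hm : m ≤ 3) {A : Set V}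
    (hA : IsTameCone m A) (h : Module.Dual ℝ V) :
    ∃ B, A ⊆ B ∧ B ⊆ A ∪ {x | 0 < h x} ∧ IsTameCone m B ∧ IsSaturatedOn m B {x | 0 < h x} := by
  obtain ⟨F₀, hF₀, hAF₀⟩ := hA.semilinear
  let F := insert h F₀
  have hF : F.Finite := hF₀.insert h
  have hAF : SignDefinable F A := hAF₀.mono (Set.subset_insert _ _)
  have : Finite F := hF
  have : Fintype (F → SignType) := Fintype.ofFinite _
  have key : ∀ s : Finset (F → SignType), ∃ B, A ⊆ B ∧ B ⊆ A ∪ {x | 0 < h x} ∧ IsTameCone m B ∧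
      IsSaturatedOn m B {x | 0 < h x ∧ ∃ σ ∈ s, x ∈ signCell F σ} := by
    classical
    intro s
    induction s using Finset.induction_on with
    | empty =>
      exact ⟨A, subset_rfl, Set.subset_union_left, hA, ∅, Set.finite_empty, by simp, by simp⟩
    | insert σ s _ ih =>
      obtain ⟨B, hAB, hBA, hB, hsat⟩ := ih
      suffices H : ∃ C, B ⊆ C ∧ C ⊆ A ∪ {x | 0 < h x} ∧ IsTameCone m C ∧
          IsSaturatedOn m C {x | 0 < h x ∧ x ∈ signCell F σ} by
        obtain ⟨C, hBC, hCA, hC, hsatC⟩ := H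
        refine ⟨C, hAB.trans hBC, hCA, hC, ?_⟩
        convert hsatC.union (hsat.mono_left hBC) using 1
        ext x
        simp [and_or_left]
      -- If one point of the cell has its negative in `A`, all do, as `A` is constant on sign cells;
      -- then no tame extension meets the cell.
      by_cases hex : 2 ≤ m ∧ ∃ q ∈ signCell F σ, -q ∈ A
      · obtain ⟨h2, q, hq, hqA⟩ := hex
        refine ⟨B, subset_rfl, hBA, hB, ∅, Set.finite_empty, by simp, ?_⟩
        rintro A' hA' hz ht x ⟨⟨hx, -, hxσ⟩, -⟩
        have hxA : -x ∈ A := hAF.neg_preimage.mem_of_mem_signCell hq hxσ hqA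
        exfalso
        refine ht.notMem_excluded hm1 (hAB.trans hA') hx (fun h => hz (h ▸ hx)) ?_
        obtain ⟨k, rfl⟩ : ∃ k, m = k + 2 := ⟨m - 2, by omega⟩
        refine ⟨Fin.cons (-x) 0, fun i => ?_, ?_⟩
        · refine Fin.cases (Or.inl hxA) (fun i => Or.inr rfl) i
        · simp [Fin.sum_univ_succ]
      · obtain ⟨C, hBC, hCB, hC, hsatC⟩ := hB.exists_saturatedOn_convex hm1 hm
          (Q := {x | 0 < h x} ∩ signCell F σ)
          (Semilinear.inter ⟨{h}, Set.finite_singleton _, fun x y hxy hx => by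
            have := hxy h rfl
            rw [Set.mem_ofPred_eq] at hx ⊢
            rw [sign_pos hx] at this
            exact sign_eq_one_iff.1 this.symm⟩ ⟨F, hF, signDefinable_signCell F σ⟩)
          (fun x hx y hy => ⟨by simpa using add_pos hx.1 hy.1, add_mem_signCell hx.2 hy.2⟩)
          (fun h0 => by simpa using h0.1)
          (fun h2 x hx hxB => by
            rcases hBA hxB with h' | h'
            · exact hex ⟨h2, x, hx.2, h'⟩
            · have h1 : 0 < h x := hx.1
              have h3 : 0 < h (-x) := h'
              rw [map_neg] at h3
              linarith)
        refine ⟨C, hBC, hCB.trans (Set.union_subset hBA fun x hx => Or.inr hx.1), hC, hsatC⟩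
  obtain ⟨B, hAB, hBA, hB, hsat⟩ := key Finset.univ
  refine ⟨B, hAB, hBA, hB, ?_⟩
  convert hsat using 1
  ext x
  simp only [Set.mem_ofPred_eq, Finset.mem_univ, true_and]
  exact ⟨fun hx => ⟨hx, _, mem_signCell_self F x⟩, fun hx => hx.1⟩

/-- For `m ≤ 3`, a tame semilinear cone extends to one that is maximal up to closure. -/
theorem IsTameCone.exists_subset_closure [Nontrivial V] {m : ℕ} (hm1 : 1 ≤ m) (hm : m ≤ 3)
    {A : Set V} (hA : IsTameCone m A) :
    ∃ B, A ⊆ B ∧ IsTameCone m B ∧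
      ∀ A', B ⊆ A' → IsOpen A' → (0 : V) ∉ A' → ConeTame m A' → A' ⊆ closure B := by
  obtain ⟨v, hv⟩ := exists_ne (0 : V)
  obtain ⟨h, hh⟩ := Module.Projective.exists_dual_ne_zero ℝ hv
  have hh0 : h ≠ 0 := fun h0 => hh (by simp [h0])
  obtain ⟨B, hAB, -, hB, hBs⟩ := hA.exists_saturatedOn_halfSpace hm1 hm h
  obtain ⟨C, hBC, -, hC, hCs⟩ := hB.exists_saturatedOn_halfSpace hm1 hm (-h)
  obtain ⟨G, hG, hG0, H⟩ := (hBs.mono_left hBC).union hCs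
  refine ⟨C, hAB.trans hBC, hC, fun A' hA' ho hz ht => ?_⟩
  -- Off `h = 0` the two half-spaces cover everything, and an open set lies in the closure of its
  -- part off the hyperplanes.
  have hd : Dense (nonvanishing (insert h G)) :=
    dense_nonvanishing (hG.insert h) (by simp [hG0, hh0.symm])
  refine (hd.open_subset_closure_inter ho).trans (closure_mono ?_)
  rintro x ⟨hx, hxg⟩
  refine H A' hA' hz ht ⟨⟨hx, ?_⟩, fun f hf => hxg f (Or.inr hf)⟩
  rcases lt_or_gt_of_ne (hxg h (Or.inl rfl)) with h' | h'
  · exact Or.inr (by simpa using h')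
  · exact Or.inl h'

end Completion

/-! ### The Fenchel–Bunt theorem. -/

section FenchelBunt

variable {V : Type*} [NormedAddCommGroup V] [NormedSpace ℝ V]

theorem eq_zero_of_sum_smul_eq_zero {T : Set V} {n : ℕ}
    (hT : ∀ z : Fin n → V, (∀ i, z i ∈ T) → ∃ f : Module.Dual ℝ V, ∀ i, 0 < f (z i))
    {ι : Type*} [Fintype ι] (hι : Fintype.card ι ≤ n) {z : ι → V} (hz : ∀ i, z i ∈ T)
    {a : ι → ℝ} (ha : ∀ i, 0 ≤ a i) (hsum : ∑ i, a i • z i = 0) (i : ι) : a i = 0 := by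
  have : Nonempty ι := ⟨i⟩
  obtain ⟨e⟩ := Function.Embedding.nonempty_of_card_le (β := Fin n) (by simpa using hι)
  -- `invFun` pads the family to an `n`-tuple by repeating points.
  obtain ⟨f, hf⟩ := hT (fun k => z (Function.invFun e k)) (fun k => hz _)
  have hfz : ∀ j, 0 < f (z j) := fun j => by
    simpa [Function.leftInverse_invFun e.injective j] using hf (e j)
  have h0 : ∑ j, a j * f (z j) = 0 := by
    simpa [map_sum] using congrArg f hsum
  have := (Finset.sum_eq_zero_iff_of_nonneg
    (fun j _ => mul_nonneg (ha j) (hfz j).le)).1 h0 i (Finset.mem_univ i)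
  exact (mul_eq_zero.1 this).resolve_right (hfz i).ne'

/-- If `0` is a positive combination of affinely independent points, then omitting one of the
points leaves a linearly independent family. -/
theorem AffineIndependent.linearIndependent_of_sum_smul_eq_zero {ι : Type*} [Fintype ι]
    {z : ι → V} (hz : AffineIndependent ℝ z) {w : ι → ℝ} (hw : ∀ i, 0 < w i)
    (hw1 : ∑ i, w i = 1) (hwz : ∑ i, w i • z i = 0) (i₀ : ι) :
    LinearIndependent ℝ fun j : {j // j ≠ i₀} => z j := by
  classical
  rw [affineIndependent_iff] at hz
  rw [Fintype.linearIndependent_iff]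
  intro b hb
  let b' : ι → ℝ := fun i => if h : i ≠ i₀ then b ⟨i, h⟩ else 0
  have hb'0 : b' i₀ = 0 := by simp [b']
  have hb' : ∀ j : {j // j ≠ i₀}, b' j = b j := fun j => by simp [b', j.2]
  have hsum : ∑ i, b' i • z i = 0 := by
    rw [← Finset.add_sum_erase _ _ (Finset.mem_univ i₀), hb'0, zero_smul, zero_add, ← hb,
      Finset.sum_subtype (p := (· ≠ i₀)) (F := inferInstance) (Finset.univ.erase i₀)
        (by simp) (fun i => b' i • z i)]
    exact Finset.sum_congr rfl fun j _ => by rw [hb']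
  -- Subtracting a multiple of the relation `w` makes the weights sum to 0; the weight at `i₀` then
  -- forces that multiple to vanish.
  have hc := hz Finset.univ (fun i => b' i - (∑ j, b' j) * w i)
    (by rw [Finset.sum_sub_distrib, ← Finset.mul_sum, hw1]; ring)
    (by
      simp only [sub_smul, mul_smul, Finset.sum_sub_distrib, ← Finset.smul_sum, hwz, hsum]
      simp)
  have hβ : ∑ j, b' j = 0 := by
    have := hc i₀ (Finset.mem_univ _)
    rw [hb'0, zero_sub, neg_eq_zero] at this
    exact (mul_eq_zero.1 this).resolve_right (hw i₀).ne'
  intro j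
  have := hc j (Finset.mem_univ _)
  rwa [hβ, zero_mul, sub_zero, hb'] at this

/-- The theorem of Fenchel and Bunt at the origin. -/
theorem zero_notMem_convexHull_iUnion [FiniteDimensional ℝ V] {n : ℕ}
    (hn : Module.finrank ℝ V = n) {D : Fin n → Set V} (hD : ∀ i, IsPreconnected (D i))
    (hT : ∀ z : Fin n → V, (∀ i, z i ∈ ⋃ j, D j) → ∃ f : Module.Dual ℝ V, ∀ i, 0 < f (z i)) :
    (0 : V) ∉ convexHull ℝ (⋃ j, D j) := by
  classical
  intro h0
  obtain ⟨ι, _, z, w, hzT, haff, hw, hw1, hwz⟩ := eq_pos_convex_span_of_mem_convexHull h0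
  have hz : ∀ i, z i ∈ ⋃ j, D j := fun i => hzT ⟨i, rfl⟩
  rcases le_or_gt (Fintype.card ι) n with hcard | hcard
  · have : ∀ i, w i = 0 :=
      eq_zero_of_sum_smul_eq_zero hT hcard hz (fun i => (hw i).le) hwz
    simp [this] at hw1
  choose k hk using fun i => Set.mem_iUnion.1 (hz i)
  -- More than `n` points lie in `n` sets, so two of them share a connected set, along which one can
  -- be moved towards the other.
  obtain ⟨i₀, i₁, hne, hk01⟩ := Fintype.exists_ne_map_eq_of_card_lt k (by simpa using hcard)
  let J := {j // j ≠ i₀}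
  have hlin : LinearIndependent ℝ fun j : J => z j :=
    haff.linearIndependent_of_sum_smul_eq_zero hw hw1 hwz i₀
  have : Nonempty J := ⟨⟨i₁, hne.symm⟩⟩
  have hJ : Fintype.card J + 1 = Fintype.card ι := by
    have h1 : 0 < Fintype.card ι := by omega
    simp only [J]
    rw [Fintype.card_subtype_compl, Fintype.card_subtype_eq]
    omega
  have hJn : Fintype.card J = n := by
    have := hlin.fintype_card_le_finrank
    omega
  let b := basisOfLinearIndependentOfCardEqFinrank hlin (hJn.trans hn.symm)
  have hb : ∀ j, b j = z j := fun j => by simp [b]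
  let μ : J → V → ℝ := fun j c => -b.coord j c
  have hμc : ∀ j, Continuous (μ j) := fun j =>
    (b.coord j).continuous_of_finiteDimensional.neg
  -- `g c ≥ 0` means that `-c` is in the cone spanned by the basis, and `g c = 0` that it is on the
  -- boundary of that cone. A zero of `g` in the shared set can thus replace a basis vector with
  -- coefficient 0, leaving a nontrivial relation among only `n` points.
  let g : V → ℝ := fun c => Finset.univ.inf' Finset.univ_nonempty fun j => μ j c
  have hg : Continuous g := Continuous.finset_inf'_apply _ fun j _ => hμc j
  have hz0 : ∀ j : J, μ j (z i₀) = (w i₀)⁻¹ * w j := by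
    intro j
    have hsub : w i₀ • z i₀ = -∑ j : J, w j • b j := by
      rw [eq_neg_iff_add_eq_zero, ← hwz, ← Finset.add_sum_erase _ _ (Finset.mem_univ i₀),
        Finset.sum_subtype (p := (· ≠ i₀)) (F := inferInstance) (Finset.univ.erase i₀)
        (by simp) (fun i => w i • z i)]
      simp only [hb, J]
    have hsub' : z i₀ = -∑ j : J, ((w i₀)⁻¹ * w j) • b j := by
      rw [← inv_smul_smul₀ (hw i₀).ne' (z i₀), hsub, smul_neg, Finset.smul_sum]
      simp only [mul_smul]
    simp only [μ]
    rw [hsub', map_neg, neg_neg, b.coord_apply, b.repr_sum_self]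
  have hg0 : 0 ≤ g (z i₀) := by
    refine Finset.le_inf' _ _ fun j _ => ?_
    rw [hz0]
    exact mul_nonneg (inv_nonneg.2 (hw _).le) (hw _).le
  have hg1 : g (z i₁) ≤ 0 := by
    refine (Finset.inf'_le _ (Finset.mem_univ (⟨i₁, hne.symm⟩ : J))).trans ?_
    simp only [μ]
    rw [← hb ⟨i₁, hne.symm⟩]
    simp
  obtain ⟨c, hcD, hc0⟩ := (hD (k i₀)).intermediate_value (hk01 ▸ hk i₁) (hk i₀) hg.continuousOn
    ⟨hg1, hg0⟩
  have hμ0 : ∀ j, 0 ≤ μ j c := fun j => hc0 ▸ Finset.inf'_le _ (Finset.mem_univ j)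
  obtain ⟨m, -, hm⟩ := Finset.exists_mem_eq_inf' (Finset.univ_nonempty (α := J)) fun j => μ j c
  have hm0 : μ m c = 0 := hm.symm.trans hc0
  have hcsum : c + ∑ j, μ j c • z j = 0 := by
    have := b.sum_repr c
    rw [← eq_neg_iff_add_eq_zero, ← Finset.sum_neg_distrib]
    conv_lhs => rw [← this]
    refine Finset.sum_congr rfl fun j _ => ?_
    simp [μ, hb]
  have := eq_zero_of_sum_smul_eq_zero hT (ι := J) hJn.le
    (z := fun j => if j = m then c else z j) (a := fun j => if j = m then 1 else μ j c)
    (fun j => by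
      split_ifs
      · exact Set.mem_iUnion.2 ⟨_, hcD⟩
      · exact hz j)
    (fun j => by
      split_ifs
      · exact zero_le_one
      · exact hμ0 j)
    (by
      rw [← hcsum, ← Finset.add_sum_erase _ _ (Finset.mem_univ m),
        ← Finset.add_sum_erase (a := m) _ (fun j => μ j c • z j) (Finset.mem_univ m), hm0]
      simp only [if_true, one_smul, zero_smul, zero_add]
      congr 1
      refine Finset.sum_congr rfl fun j hj => ?_
      rw [if_neg (Finset.ne_of_mem_erase hj), if_neg (Finset.ne_of_mem_erase hj)]) m
  simp at this

/-- Open connected sets as many as the dimension lie in a common open half-space as soon as their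
points do so. -/
theorem exists_dual_pos_of_isOpen_iUnion [FiniteDimensional ℝ V] {n : ℕ}
    (hn : Module.finrank ℝ V = n) {D : Fin n → Set V} (hD : ∀ i, IsPreconnected (D i))
    (ho : ∀ i, IsOpen (D i))
    (hT : ∀ z : Fin n → V, (∀ i, z i ∈ ⋃ j, D j) → ∃ f : Module.Dual ℝ V, ∀ i, 0 < f (z i)) :
    ∃ f : StrongDual ℝ V, ∀ i, ∀ x ∈ D i, 0 < f x := by
  obtain ⟨f, hf⟩ := geometric_hahn_banach_open_point (convex_convexHull ℝ _)
    (isOpen_iUnion ho).convexHull (zero_notMem_convexHull_iUnion hn hD hT)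
  refine ⟨-f, fun i x hx => ?_⟩
  have := hf x (subset_convexHull ℝ _ (Set.mem_iUnion.2 ⟨i, hx⟩))
  simpa using this

end FenchelBunt

/-! ### Counting connected components. -/

section Components

open Set

/-- `V` is a finite union of preconnected sets. -/
def HasFinitePreconnectedCover {X : Type*} [TopologicalSpace X] (V : Set X) : Prop :=
  ∃ 𝒟 : Set (Set X), 𝒟.Finite ∧ (∀ D ∈ 𝒟, IsPreconnected D) ∧ ⋃₀ 𝒟 = V

variable {X : Type*} [TopologicalSpace X]

/-- Each component meets a member of the cover, and a preconnected member meets only one component.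
-/
theorem HasFinitePreconnectedCover.finite_connectedComponents {V : Set X}
    (h : HasFinitePreconnectedCover V) : Finite (ConnectedComponents V) := by
  obtain ⟨𝒟, hfin, hpre, hV⟩ := h
  have hex : ∀ a : ConnectedComponents V, ∃ D ∈ 𝒟, ∃ x : V, ConnectedComponents.mk x = a ∧
      (x : X) ∈ D := by
    intro a
    obtain ⟨x, rfl⟩ := ConnectedComponents.surjective_coe a
    obtain ⟨D, hD, hx⟩ := (hV ▸ x.2 : (x : X) ∈ ⋃₀ 𝒟)
    exact ⟨D, hD, x, rfl, hx⟩
  choose D hD x hx hxD using hex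
  have : Finite 𝒟 := hfin
  refine Finite.of_injective (fun a => (⟨D a, hD a⟩ : 𝒟)) fun a b hab => ?_
  have hab' : D a = D b := congrArg Subtype.val hab
  have hsub : D a ⊆ range (Subtype.val : V → X) := by
    rw [Subtype.range_val, ← hV]
    exact subset_sUnion_of_mem (hD a)
  have hc : IsPreconnected ((Subtype.val : V → X) ⁻¹' D a) := by
    rw [← Topology.IsInducing.subtypeVal.isPreconnected_image, image_preimage_eq_of_subset hsub]
    exact hpre _ (hD a)
  rw [← hx a, ← hx b, ConnectedComponents.coe_eq_coe']
  exact hc.subset_connectedComponent (by simpa [hab'] using hxD b) (hxD a)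

/-- Closure commutes with finite unions, and any set between a preconnected set and its closure is
preconnected. -/
theorem HasFinitePreconnectedCover.of_subset_closure {V M : Set X}
    (h : HasFinitePreconnectedCover V) (hVM : V ⊆ M) (hM : M ⊆ closure V) :
    HasFinitePreconnectedCover M := by
  obtain ⟨𝒟, hfin, hpre, hV⟩ := h
  have hcl : closure V = ⋃ D ∈ 𝒟, closure D := by
    rw [← hV, sUnion_eq_biUnion, hfin.closure_biUnion]
  refine ⟨(fun D => closure D ∩ M) '' 𝒟, hfin.image _, ?_, ?_⟩
  · rintro _ ⟨D, hD, rfl⟩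
    refine (hpre D hD).subset_closure (subset_inter subset_closure ?_) inter_subset_left
    exact (subset_sUnion_of_mem hD).trans (hV.subset.trans hVM)
  · rw [sUnion_image]
    apply subset_antisymm
    · simp
    · intro x hx
      have := hM hx
      rw [hcl] at this
      simp only [mem_iUnion] at this ⊢
      obtain ⟨D, hD, hxD⟩ := this
      exact ⟨D, hD, hxD, hx⟩

/-- Representatives of `k + 1` components of the union would all lie in one member of the chain, in
distinct components of it, since inclusions map components into components. -/
theorem card_connectedComponents_sUnion_le {c : Set (Set X)} (hc : IsChain (· ⊆ ·) c)
    (hne : c.Nonempty) {k : ℕ∞} (hk : ∀ V ∈ c, ENat.card (ConnectedComponents V) ≤ k) :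
    ENat.card (ConnectedComponents (⋃₀ c)) ≤ k := by
  by_contra! hlt
  obtain ⟨m, rfl⟩ := ENat.ne_top_iff_exists.1 hlt.ne_top
  rw [← encard_univ] at hlt
  obtain ⟨t, -, ht⟩ := exists_subset_encard_eq (Order.add_one_le_of_lt hlt)
  have htf : t.Finite := finite_of_encard_eq_coe (k := m + 1) (by simpa using ht)
  choose s hs using ConnectedComponents.surjective_coe (α := (⋃₀ c : Set X))
  obtain ⟨V, hV, hsub⟩ := hc.directedOn.exists_mem_subset_of_finite_of_subset_sUnion hne
    (htf.image fun a => (s a : X)) (by rintro _ ⟨a, _, rfl⟩; exact (s a).2)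
  have hVc : V ⊆ ⋃₀ c := subset_sUnion_of_mem hV
  have hinj : Function.Injective fun a : t =>
      (ConnectedComponents.mk ⟨s a, hsub ⟨a, a.2, rfl⟩⟩ : ConnectedComponents V) := by
    intro a b hab
    have := congrArg (continuous_inclusion hVc).connectedComponentsMap hab
    simp only [Continuous.connectedComponentsMap_mk] at this
    have h2 : ConnectedComponents.mk (s a) = ConnectedComponents.mk (s b) := this
    exact Subtype.ext (by rwa [hs, hs] at h2)
  have := (ENat.card_le_card_of_injective hinj).trans (hk V hV)
  rw [ENat.card_coe_set_eq, ht] at this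
  exact absurd this (not_le.2 (by exact_mod_cast Nat.lt_succ_self m))

end Components

/-! ### Passing between the sphere and cones. -/

section Cones

open Set Pointwise

variable {n : ℕ}

/-- The open cone over a subset of the sphere. -/
def sphereCone (V : Set (UnitSphere n)) : Set (EuclideanSpace ℝ (Fin n)) :=
  Ioi (0 : ℝ) • (Subtype.val '' V)

theorem mem_sphereCone {V : Set (UnitSphere n)} {x : EuclideanSpace ℝ (Fin n)} :
    x ∈ sphereCone V ↔ ∃ r : ℝ, 0 < r ∧ ∃ s ∈ V, r • (s : EuclideanSpace ℝ (Fin n)) = x := by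
  simp [sphereCone, Set.mem_smul]

theorem coe_mem_sphereCone {V : Set (UnitSphere n)} {s : UnitSphere n} (hs : s ∈ V) :
    (s : EuclideanSpace ℝ (Fin n)) ∈ sphereCone V :=
  mem_sphereCone.2 ⟨1, one_pos, s, hs, one_smul _ _⟩

theorem isOpen_sphereCone {V : Set (UnitSphere n)} (hV : IsOpen V) : IsOpen (sphereCone V) :=
  isOpen_Ioi.smul_sphere one_ne_zero (by simp) hV

theorem isPreconnected_sphereCone {V : Set (UnitSphere n)} (hV : IsPreconnected V) :
    IsPreconnected (sphereCone V) := by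
  have : sphereCone V =
      (fun p : ℝ × UnitSphere n => p.1 • (p.2 : EuclideanSpace ℝ (Fin n))) '' (Ioi 0 ×ˢ V) := by
    ext x
    simp only [mem_sphereCone, mem_image, mem_prod, mem_Ioi, Prod.exists]
    exact ⟨fun ⟨r, hr, s, hs, h⟩ => ⟨r, s, ⟨hr, hs⟩, h⟩,
      fun ⟨r, s, ⟨hr, hs⟩, h⟩ => ⟨r, hr, s, hs, h⟩⟩
  rw [this]
  exact (isPreconnected_Ioi.prod hV).image _ (by fun_prop)

theorem zero_notMem_sphereCone (V : Set (UnitSphere n)) : 0 ∉ sphereCone V := by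
  rw [mem_sphereCone]
  rintro ⟨r, hr, s, -, h⟩
  rcases smul_eq_zero.1 h with h | h
  · exact hr.ne' h
  · exact ne_zero_of_mem_unit_sphere s h

/-- The normalisation of a nonzero vector. -/
noncomputable def toUnitSphere (x : EuclideanSpace ℝ (Fin n)) (hx : x ≠ 0) : UnitSphere n :=
  ⟨‖x‖⁻¹ • x, by simp [norm_smul, hx]⟩

theorem norm_smul_toUnitSphere {x : EuclideanSpace ℝ (Fin n)} (hx : x ≠ 0) :
    ‖x‖ • (toUnitSphere x hx : EuclideanSpace ℝ (Fin n)) = x := by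
  simp [toUnitSphere, smul_smul, hx]

theorem Semilinear.sphereCone_preimage {A : Set (EuclideanSpace ℝ (Fin n))} (hA : Semilinear A)
    (h0 : 0 ∉ A) : sphereCone (Subtype.val ⁻¹' A : Set (UnitSphere n)) = A := by
  ext x
  rw [mem_sphereCone]
  constructor
  · rintro ⟨r, hr, s, hs, rfl⟩
    exact hA.smul_mem hs hr
  · intro hx
    have hx0 : x ≠ 0 := fun h => h0 (h ▸ hx)
    exact ⟨‖x‖, norm_pos_iff.2 hx0, toUnitSphere x hx0,
      hA.smul_mem hx (inv_pos.2 (norm_pos_iff.2 hx0)), norm_smul_toUnitSphere hx0⟩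

/-- The sign cells that meet `A` lie in `A`; they are convex, and normalisation maps them
continuously onto their traces on the sphere. -/
theorem Semilinear.hasFinitePreconnectedCover {A : Set (EuclideanSpace ℝ (Fin n))}
    (hA : Semilinear A) (h0 : 0 ∉ A) :
    HasFinitePreconnectedCover (Subtype.val ⁻¹' A : Set (UnitSphere n)) := by
  obtain ⟨F, hF, hA⟩ := hA
  have : Finite F := hF
  let cells : Set (F → SignType) := {σ | (signCell F σ ∩ A).Nonempty}
  refine ⟨(fun σ => Subtype.val ⁻¹' signCell F σ) '' cells, (toFinite cells).image _, ?_, ?_⟩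
  · rintro _ ⟨σ, ⟨y, hy, hyA⟩, rfl⟩
    have hsub : signCell F σ ⊆ A := fun x hx => hA.mem_of_mem_signCell hy hx hyA
    rw [← Topology.IsInducing.subtypeVal.isPreconnected_image]
    convert (convex_signCell F σ).isPreconnected.image (fun x => ‖x‖⁻¹ • x)
      (ContinuousOn.smul (ContinuousOn.inv₀ (by fun_prop)
        fun x hx => norm_ne_zero_iff.2 fun h => h0 (h ▸ hsub hx)) (by fun_prop)) using 1
    ext x
    constructor
    · rintro ⟨s, hs, rfl⟩
      exact ⟨s, hs, by simp⟩
    · rintro ⟨z, hz, rfl⟩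
      have hz0 : z ≠ 0 := fun h => h0 (h ▸ hsub hz)
      exact ⟨toUnitSphere z hz0,
        (signDefinable_signCell F σ).smul_mem hz (inv_pos.2 (norm_pos_iff.2 hz0)), rfl⟩
  · ext s
    simp only [sUnion_image, mem_iUnion, mem_preimage]
    constructor
    · rintro ⟨σ, ⟨y, hy, hyA⟩, hs⟩
      exact hA.mem_of_mem_signCell hy hs hyA
    · intro hs
      exact ⟨_, ⟨s, mem_signCell_self F _, hs⟩, mem_signCell_self F _⟩

end Cones

/-! ### Equivalence of spherical and conical tameness. -/

section Tame

open Set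

variable {n : ℕ}

theorem IsTame.exists_hemisphere {V : Set (UnitSphere n)} (hV : IsTame n V) {ι : Type*}
    [Fintype ι] [Nonempty ι] (hι : Fintype.card ι ≤ n) (z : ι → UnitSphere n)
    (hz : ∀ i, z i ∈ V) : ∃ v : UnitSphere n, ∀ i, z i ∈ openHemisphere v := by
  classical
  obtain ⟨v, hv⟩ := hV (Finset.univ.image z) (by simp)
    (Finset.card_image_le.trans (by simpa using hι)) (by simpa [Set.range_subset_iff] using hz)
  exact ⟨v, fun i => hv (by simp)⟩

theorem isTame_of_forall_exists_hemisphere {V : Set (UnitSphere n)}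
    (h : ∀ z : Fin n → UnitSphere n, (∀ i, z i ∈ V) → ∃ v, ∀ i, z i ∈ openHemisphere v) :
    IsTame n V := by
  intro F hF hcard hFV
  obtain ⟨e⟩ := Function.Embedding.nonempty_of_card_le (α := F) (β := Fin n) (by simpa using hcard)
  have : Nonempty F := hF.to_subtype
  obtain ⟨v, hv⟩ := h (fun k => (Function.invFun e k : F)) fun k => hFV (Subtype.prop _)
  exact ⟨v, fun x hx => by
    simpa [Function.leftInverse_invFun e.injective (⟨x, hx⟩ : F)] using hv (e ⟨x, hx⟩)⟩

theorem isTame_sUnion {m : ℕ} {c : Set (Set (UnitSphere n))} (hc : IsChain (· ⊆ ·) c)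
    (hne : c.Nonempty) (h : ∀ V ∈ c, IsTame m V) : IsTame m (⋃₀ c) := by
  intro F hF hcard hFc
  obtain ⟨V, hV, hFV⟩ := hc.directedOn.exists_mem_subset_of_finite_of_subset_sUnion hne
    F.finite_toSet hFc
  exact h V hV F hF hcard hFV

/-- The nonzero terms have positive inner product with the centre of a common hemisphere, so they
cannot cancel. -/
theorem IsTame.coneTame {V : Set (UnitSphere n)} (hV : IsTame n V) :
    ConeTame n (sphereCone V) := by
  classical
  intro z hz hsum i
  by_contra hi
  let I := {j // z j ≠ 0}
  have hzI : ∀ j : I, ∃ r : ℝ, 0 < r ∧ ∃ s ∈ V, r • (s : EuclideanSpace ℝ (Fin n)) = z j :=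
    fun j => mem_sphereCone.1 ((hz j).resolve_right j.2)
  choose r hr s hs hrs using hzI
  have : Nonempty I := ⟨⟨i, hi⟩⟩
  obtain ⟨v, hv⟩ := hV.exists_hemisphere
    ((Fintype.card_subtype_le _).trans (Fintype.card_fin n).le) s hs
  have hpos : ∀ j, z j ≠ 0 → 0 < inner ℝ (z j) (v : EuclideanSpace ℝ (Fin n)) := by
    intro j hj
    rw [← hrs ⟨j, hj⟩, real_inner_smul_left]
    exact mul_pos (hr _) (hv _)
  have : 0 < ∑ j, inner ℝ (z j) (v : EuclideanSpace ℝ (Fin n)) := by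
    refine Finset.sum_pos' (fun j _ => ?_) ⟨i, Finset.mem_univ i, hpos i hi⟩
    by_cases hj : z j = 0
    · simp [hj]
    · exact (hpos j hj).le
  rw [← sum_inner, hsum, inner_zero_left] at this
  exact lt_irrefl _ this

theorem exists_hemisphere_of_strongDual (f : StrongDual ℝ (EuclideanSpace ℝ (Fin n)))
    (hf : f ≠ 0) : ∃ v : UnitSphere n, ∀ s : UnitSphere n, 0 < f s → s ∈ openHemisphere v := by
  let y := (InnerProductSpace.toDual ℝ (EuclideanSpace ℝ (Fin n))).symm f
  have hy : y ≠ 0 := by simpa [y] using hf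
  refine ⟨toUnitSphere y hy, fun s hs => ?_⟩
  have h1 : inner ℝ y (s : EuclideanSpace ℝ (Fin n)) = f s :=
    InnerProductSpace.toDual_symm_apply
  simp only [openHemisphere, mem_ofPred_eq, toUnitSphere, real_inner_smul_right]
  rw [real_inner_comm, h1]
  exact mul_pos (inv_pos.2 (norm_pos_iff.2 hy)) hs

/-- If 0 were in the convex hull of the points, the weighted points, padded by zeros, would be a
forbidden vanishing sum. Otherwise a functional separating 0 from the hull gives the hemisphere. -/
theorem ConeTame.isTame {A : Set (EuclideanSpace ℝ (Fin n))} (hA : Semilinear A)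
    (ht : ConeTame n A) : IsTame n (Subtype.val ⁻¹' A : Set (UnitSphere n)) := by
  classical
  intro F hF hcard hFA
  let F' : Finset (EuclideanSpace ℝ (Fin n)) := F.image Subtype.val
  have h0 : 0 ∉ convexHull ℝ (F' : Set (EuclideanSpace ℝ (Fin n))) := by
    rw [Finset.mem_convexHull']
    rintro ⟨w, hw, hw1, hw0⟩
    obtain ⟨e⟩ := Function.Embedding.nonempty_of_card_le (α := F') (β := Fin n)
      (by simpa using Finset.card_image_le.trans hcard)
    let g : F' → EuclideanSpace ℝ (Fin n) := fun y => w y • (y : EuclideanSpace ℝ (Fin n))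
    have hmem : ∀ y : F', (y : EuclideanSpace ℝ (Fin n)) ∈ A ∧
        (y : EuclideanSpace ℝ (Fin n)) ≠ 0 := by
      rintro ⟨y, hy⟩
      obtain ⟨s, hs, rfl⟩ := Finset.mem_image.1 hy
      exact ⟨hFA hs, ne_zero_of_mem_unit_sphere s⟩
    have hz := ht (Function.extend e g 0) (fun k => by
      by_cases hk : ∃ y, e y = k
      · obtain ⟨y, rfl⟩ := hk
        rw [e.injective.extend_apply]
        rcases (hw y y.2).eq_or_lt with h | h
        · exact Or.inr (by simp [g, ← h])
        · exact Or.inl (hA.smul_mem (hmem y).1 h)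
      · exact Or.inr (Function.extend_apply' _ _ _ hk)) (by
      rw [← hw0, ← Finset.sum_coe_sort F']
      refine (Finset.sum_of_injOn (s := Finset.univ) (t := Finset.univ) (f := g) e
        e.injective.injOn (fun _ _ => Finset.mem_coe.2 (Finset.mem_univ _)) (fun k _ hk => ?_)
        (fun y _ => ?_)).symm
      · exact Function.extend_apply' _ _ _ (by simpa using hk)
      · exact (e.injective.extend_apply g 0 y).symm)
    have hw' : ∀ y ∈ F', w y = 0 := by
      intro y hy
      have := hz (e ⟨y, hy⟩)
      rw [e.injective.extend_apply] at this
      exact (smul_eq_zero.1 this).resolve_right (hmem ⟨y, hy⟩).2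
    rw [Finset.sum_eq_zero hw'] at hw1
    exact zero_ne_one hw1
  obtain ⟨f, u, hfu, hf⟩ := geometric_hahn_banach_point_closed (convex_convexHull ℝ _)
    (F'.finite_toSet.isClosed_convexHull ℝ) h0
  have hpos : ∀ s ∈ F, 0 < f (s : EuclideanSpace ℝ (Fin n)) := fun s hs => by
    rw [map_zero] at hfu
    exact hfu.trans (hf _ (subset_convexHull ℝ _ (Finset.mem_image_of_mem _ hs)))
  obtain ⟨s₀, hs₀⟩ := hF
  obtain ⟨v, hv⟩ := exists_hemisphere_of_strongDual f fun h => by simpa [h] using hpos s₀ hs₀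
  exact ⟨v, fun s hs => hv s (hpos s hs)⟩

end Tame

/-! ### Finitely many hemispheres and the semilinear enlargement. -/

section Covering

open Set

variable {n : ℕ}

theorem isOpen_openHemisphere (v : UnitSphere n) : IsOpen (openHemisphere v) :=
  isOpen_lt continuous_const (by fun_prop)

/-- Finitely many open hemispheres suffice for all `n`-tuples in a closed tame set. -/
theorem IsTame.exists_finite_hemispheres_of_isClosed (hn : n ≠ 0) {U : Set (UnitSphere n)}
    (hU : IsTame n U) (hc : IsClosed U) :
    ∃ J : Set (UnitSphere n), J.Finite ∧
      ∀ z : Fin n → UnitSphere n, (∀ i, z i ∈ U) → ∃ v ∈ J, ∀ i, z i ∈ openHemisphere v := by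
  have : NeZero n := ⟨hn⟩
  have hK : IsCompact (Set.pi univ fun _ : Fin n => U) :=
    isCompact_univ_pi fun _ => hc.isCompact
  obtain ⟨t, ht⟩ := hK.elim_finite_subcover
    (fun v : UnitSphere n => Set.pi univ fun _ : Fin n => openHemisphere v)
    (fun v => isOpen_set_pi finite_univ fun _ _ => isOpen_openHemisphere v)
    (fun z hz => by
      obtain ⟨v, hv⟩ := hU.exists_hemisphere (by simp) z fun i => hz i trivial
      exact mem_iUnion.2 ⟨v, fun i _ => hv i⟩)
  refine ⟨t, t.finite_toSet, fun z hz => ?_⟩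
  obtain ⟨v, hv, hzv⟩ := mem_iUnion₂.1 (ht fun i _ => hz i)
  exact ⟨v, hv, fun i => hzv i trivial⟩

/-- Finitely many open hemispheres suffice for all `n`-tuples in an open tame set with finitely
many components. -/
theorem IsTame.exists_finite_hemispheres_of_isOpen (hn : n ≠ 0) {U : Set (UnitSphere n)}
    (hU : IsTame n U) (ho : IsOpen U) (hfin : Finite (ConnectedComponents U)) :
    ∃ J : Set (UnitSphere n), J.Finite ∧
      ∀ z : Fin n → UnitSphere n, (∀ i, z i ∈ U) → ∃ v ∈ J, ∀ i, z i ∈ openHemisphere v := by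
  have : NeZero n := ⟨hn⟩
  let D : ConnectedComponents U → Set (UnitSphere n) := fun a =>
    Subtype.val '' (ConnectedComponents.mk ⁻¹' {a})
  have hDU : ∀ a, D a ⊆ U := by
    rintro a _ ⟨x, -, rfl⟩
    exact x.2
  have hD : ∀ a, IsPreconnected (D a) := by
    intro a
    obtain ⟨x, rfl⟩ := ConnectedComponents.surjective_coe a
    refine IsPreconnected.image ?_ _ continuous_subtype_val.continuousOn
    rw [connectedComponents_preimage_singleton]
    exact isPreconnected_connectedComponent
  -- The finite space of components is discrete, so each component is open.
  have hDo : ∀ a, IsOpen (D a) := fun a =>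
    ho.isOpenMap_subtype_val _ ((isOpen_discrete {a}).preimage ConnectedComponents.continuous_coe)
  have hDne : ∀ a, (D a).Nonempty := by
    intro a
    obtain ⟨x, rfl⟩ := ConnectedComponents.surjective_coe a
    exact ⟨x, x, rfl, rfl⟩
  have key : ∀ C : Fin n → ConnectedComponents U, ∃ v : UnitSphere n, ∀ i,
      D (C i) ⊆ openHemisphere v := by
    intro C
    obtain ⟨f, hf⟩ := exists_dual_pos_of_isOpen_iUnion (V := EuclideanSpace ℝ (Fin n)) (by simp)
      (D := fun i => sphereCone (D (C i))) (fun i => isPreconnected_sphereCone (hD _))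
      (fun i => isOpen_sphereCone (hDo _)) (fun z hz => by
        have hz' : ∀ i, ∃ r : ℝ, 0 < r ∧ ∃ s ∈ U, r • (s : EuclideanSpace ℝ (Fin n)) = z i := by
          intro i
          obtain ⟨j, hj⟩ := mem_iUnion.1 (hz i)
          obtain ⟨r, hr, s, hs, h⟩ := mem_sphereCone.1 hj
          exact ⟨r, hr, s, hDU _ hs, h⟩
        choose r hr s hs hrs using hz'
        obtain ⟨v, hv⟩ := hU.exists_hemisphere (by simp) s hs
        refine ⟨(innerSL ℝ (v : EuclideanSpace ℝ (Fin n))).toLinearMap, fun i => ?_⟩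
        rw [← hrs i]
        simp only [ContinuousLinearMap.coe_coe, innerSL_apply_apply, real_inner_smul_right]
        rw [real_inner_comm]
        exact mul_pos (hr i) (hv i))
    have hpos : ∀ i, ∀ s ∈ D (C i), 0 < f (s : EuclideanSpace ℝ (Fin n)) :=
      fun i s hs => hf i s (coe_mem_sphereCone hs)
    obtain ⟨s, hs⟩ := hDne (C 0)
    obtain ⟨v, hv⟩ := exists_hemisphere_of_strongDual f fun h => by simpa [h] using hpos 0 s hs
    exact ⟨v, fun i s hs => hv s (hpos i s hs)⟩
  choose v hv using key
  refine ⟨range v, finite_range v, fun z hz => ?_⟩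
  exact ⟨_, ⟨fun i => ConnectedComponents.mk ⟨z i, hz i⟩, rfl⟩,
    fun i => hv _ i ⟨⟨z i, hz i⟩, rfl, rfl⟩⟩

/-- A set covered, together with its `n`-tuples, by finitely many open hemispheres lies in a
semilinear open tame set. -/
theorem exists_isTameCone_of_finite_hemispheres (hn : n ≠ 0) {U J : Set (UnitSphere n)}
    (hJ : J.Finite)
    (hUJ : ∀ z : Fin n → UnitSphere n, (∀ i, z i ∈ U) → ∃ v ∈ J, ∀ i, z i ∈ openHemisphere v) :
    ∃ A : Set (EuclideanSpace ℝ (Fin n)), IsTameCone n A ∧ U ⊆ Subtype.val ⁻¹' A := by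
  have : NeZero n := ⟨hn⟩
  -- `y` has to lie in every hemisphere of `J` around some witness `x ∈ U`. A tuple in `A` therefore
  -- lies in any member of `J` that contains its tuple of witnesses.
  let A : Set (EuclideanSpace ℝ (Fin n)) := {y | ∃ x ∈ U, ∀ v ∈ J, x ∈ openHemisphere v →
    0 < inner ℝ y (v : EuclideanSpace ℝ (Fin n))}
  have hA : Semilinear A := by
    refine ⟨(fun v : UnitSphere n =>
      (innerSL ℝ (v : EuclideanSpace ℝ (Fin n))).toLinearMap) '' J, hJ.image _, ?_⟩
    rintro y y' hyy ⟨x, hx, hxy⟩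
    refine ⟨x, hx, fun v hv hxv => ?_⟩
    have h1 := hxy v hv hxv
    have h2 := hyy _ ⟨v, hv, rfl⟩
    simp only [ContinuousLinearMap.coe_coe, innerSL_apply_apply] at h2
    rw [real_inner_comm] at h1 ⊢
    rw [sign_pos h1] at h2
    exact sign_eq_one_iff.1 h2.symm
  have hAo : IsOpen A := by
    have : A = ⋃ x ∈ U, ⋂ v ∈ {v ∈ J | x ∈ openHemisphere v},
        {y | 0 < inner ℝ y (v : EuclideanSpace ℝ (Fin n))} := by
      ext y
      simp [A]
    rw [this]
    exact isOpen_biUnion fun x _ => (hJ.subset (sep_subset _ _)).isOpen_biInter fun v _ =>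
      isOpen_lt continuous_const (by fun_prop)
  have hA0 : 0 ∉ A := by
    rintro ⟨x, hx, h⟩
    obtain ⟨v, hv, hxv⟩ := hUJ (fun _ => x) fun _ => hx
    simpa using h v hv (hxv 0)
  have hAt : IsTame n (Subtype.val ⁻¹' A : Set (UnitSphere n)) := by
    refine isTame_of_forall_exists_hemisphere fun z hz => ?_
    choose x hx hxz using hz
    obtain ⟨v, hv, hxv⟩ := hUJ x hx
    exact ⟨v, fun i => hxz i v hv (hxv i)⟩
  refine ⟨A, ⟨hAo, hA, hA0, ?_⟩, fun x hx => ⟨x, hx, fun v _ h => h⟩⟩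
  rw [← hA.sphereCone_preimage hA0]
  exact hAt.coneTame

end Covering

/-! ### Maximal tame sets from Zorn's lemma. -/

section Maximal

open Set

variable {n : ℕ}

/-- Zorn's lemma uses the component bound of `V`; as the resulting `W` obeys it, `W` is also maximal
for its own, possibly smaller, bound. -/
theorem exists_isWeaklyMaxtame {V : Set (UnitSphere n)} (ho : IsOpen V) (ht : IsTame n V)
    (hfin : Finite (ConnectedComponents V)) : ∃ W, IsWeaklyMaxtame W ∧ V ⊆ W := by
  obtain ⟨W, hVW, hW⟩ := zorn_subset_nonempty
    {W : Set (UnitSphere n) | IsOpen W ∧ IsTame n W ∧ numComponents W ≤ numComponents V}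
    (fun c hcS hc hne => ⟨⋃₀ c, ⟨isOpen_sUnion fun W hW => (hcS hW).1,
      isTame_sUnion hc hne fun W hW => (hcS hW).2.1,
      card_connectedComponents_sUnion_le hc hne fun W hW => (hcS hW).2.2⟩,
      fun W hW => subset_sUnion_of_mem hW⟩) V ⟨ho, ht, le_rfl⟩
  refine ⟨W, ⟨hW.prop.1, hW.prop.2.1, ?_, ⟨hW.prop.1, hW.prop.2.1, le_rfl⟩, ?_⟩, hVW⟩
  · rw [← ENat.card_lt_top] at hfin ⊢
    exact hW.prop.2.2.trans_lt hfin
  · exact fun W' hW' hWW' =>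
      hW.le_of_ge ⟨hW'.1, hW'.2.1, hW'.2.2.trans hW.prop.2.2⟩ hWW'

theorem exists_isMaxtame (hn : n ≠ 0) (hn3 : n ≤ 3) {A : Set (EuclideanSpace ℝ (Fin n))}
    (hA : IsTameCone n A) :
    ∃ W : Set (UnitSphere n), IsMaxtame W ∧ Subtype.val ⁻¹' A ⊆ W := by
  have : NeZero n := ⟨hn⟩
  obtain ⟨B, hAB, hB, hmax⟩ := hA.exists_subset_closure (Nat.one_le_iff_ne_zero.2 hn) hn3
  let M : Set (UnitSphere n) := Subtype.val ⁻¹' B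
  obtain ⟨W, hMW, hW⟩ := zorn_subset_nonempty
    {W : Set (UnitSphere n) | IsOpen W ∧ IsTame n W}
    (fun c hcS hc hne => ⟨⋃₀ c, ⟨isOpen_sUnion fun W hW => (hcS hW).1,
      isTame_sUnion hc hne fun W hW => (hcS hW).2⟩,
      fun W hW => subset_sUnion_of_mem hW⟩) M
    ⟨hB.isOpen.preimage continuous_subtype_val, hB.coneTame.isTame hB.semilinear⟩
  have hBW : B ⊆ sphereCone W := by
    rw [← hB.semilinear.sphereCone_preimage hB.zero_notMem]
    exact smul_subset_smul_left (image_mono hMW)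
  have hcl := hmax _ hBW (isOpen_sphereCone hW.prop.1) (zero_notMem_sphereCone W)
    hW.prop.2.coneTame
  -- The inclusion in `closure B` descends to the sphere: the cone over a neighbourhood `O` is open
  -- and so meets `B`, and rescaling gives a point of `O ∩ M`.
  have hWM : W ⊆ closure M := by
    intro x hx
    rw [mem_closure_iff]
    intro O hO hxO
    obtain ⟨y, hyO, hyB⟩ := mem_closure_iff.1 (hcl (coe_mem_sphereCone hx)) _
      (isOpen_sphereCone hO) (coe_mem_sphereCone hxO)
    obtain ⟨r, hr, s, hs, rfl⟩ := mem_sphereCone.1 hyO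
    refine ⟨s, hs, ?_⟩
    have := hB.semilinear.smul_mem hyB (inv_pos.2 hr)
    rwa [inv_smul_smul₀ hr.ne'] at this
  have hfin : Finite (ConnectedComponents W) :=
    ((hB.semilinear.hasFinitePreconnectedCover hB.zero_notMem).of_subset_closure hMW
      hWM).finite_connectedComponents
  exact ⟨W, ⟨⟨hW.prop.1, hW.prop.2, hfin, ⟨hW.prop.1, hW.prop.2, le_rfl⟩,
    fun W' hW' h => hW.le_of_ge ⟨hW'.1, hW'.2.1⟩ h⟩, hW⟩, (preimage_mono hAB).trans hMW⟩

end Maximal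

theorem theoremB (n : ℕ) (U : Set (UnitSphere n)) (hU : IsTame n U)
    (hU' : IsClosed U ∨ (IsOpen U ∧ Finite (ConnectedComponents U))) :
    (∃ W : Set (UnitSphere n), IsWeaklyMaxtame W ∧ U ⊆ W) ∧
    (n ≤ 3 → ∃ W : Set (UnitSphere n), IsMaxtame W ∧ U ⊆ W) := by
  rcases eq_or_ne n 0 with rfl | hn
  · have : IsEmpty (UnitSphere 0) :=
      ⟨fun x => ne_zero_of_mem_unit_sphere x (Subsingleton.elim _ _)⟩
    have hw : IsWeaklyMaxtame U := by
      refine ⟨?_, hU, inferInstance, ⟨?_, hU, le_rfl⟩, fun V _ _ => ?_⟩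
      · rw [Set.eq_empty_of_isEmpty U]
        exact isOpen_empty
      · rw [Set.eq_empty_of_isEmpty U]
        exact isOpen_empty
      · exact (Set.eq_empty_of_isEmpty V).le.trans (Set.empty_subset U)
    exact ⟨⟨U, hw, subset_rfl⟩, fun _ => ⟨U, ⟨hw, ⟨hw.1, hU⟩,
      fun V _ _ => (Set.eq_empty_of_isEmpty V).le.trans (Set.empty_subset U)⟩, subset_rfl⟩⟩
  · obtain ⟨J, hJ, hUJ⟩ : ∃ J : Set (UnitSphere n), J.Finite ∧ ∀ z : Fin n → UnitSphere n,
        (∀ i, z i ∈ U) → ∃ v ∈ J, ∀ i, z i ∈ openHemisphere v := by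
      rcases hU' with hc | ⟨ho, hfin⟩
      · exact hU.exists_finite_hemispheres_of_isClosed hn hc
      · exact hU.exists_finite_hemispheres_of_isOpen hn ho hfin
    obtain ⟨A, hA, hUA⟩ := exists_isTameCone_of_finite_hemispheres hn hJ hUJ
    constructor
    · obtain ⟨W, hW, hAW⟩ := exists_isWeaklyMaxtame
        (hA.isOpen.preimage continuous_subtype_val) (hA.coneTame.isTame hA.semilinear)
        (hA.semilinear.hasFinitePreconnectedCover hA.zero_notMem).finite_connectedComponents
      exact ⟨W, hW, hUA.trans hAW⟩
    · intro hn3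
      obtain ⟨W, hW, hAW⟩ := exists_isMaxtame hn hn3 hA
      exact ⟨W, hW, hUA.trans hAW⟩
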